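/- Let $\mathcal M$ be a matroid on $[n]=\{1,\dots,n\}$ (loops and parallel elements allowed), let $\mathbb K$ be a field and $\ell\ge 0$. Given scalars $\beta_{i,j}\in\mathbb K^*$ for $i<j$, let $\mathfrak A$ be the $\mathbb K$-algebra generated by $e_1,\dots,e_n$ with relations $e_i^2=0$ and $e_je_i=\beta_{i,j}e_ie_j$ for $i<j$. For $X=\{i_1<\dots<i_m\}\subseteq[n]$ put $e_X=e_{i_1}\cdots e_{i_m}$. Given a map $\chi:2^{[n]}\to\mathbb K$, put $\partial e_X=\sum_{p=1}^m(-1)^p\chi(X\setminus i_p)\,e_{X\setminus i_p}$ if $m\ge 2$, and $\partial e_i=1$ for each $i$. Assume that $\chi$ defines a $\chi$-algebra of $\mathcal M$, that is: (i) $\chi(I)\neq0$ if and only if $I$ is independent; (ii) for any two sets $U'\subseteq U$ each of which contains a unique circuit of $\mathcal M$ there is $\varepsilon\in\mathbb K^*$ with $\partial e_U=\varepsilon\,(\partial e_{U'})\,e_{U\setminus U'}$. Let $\mathbb A=\mathfrak A/\Im$, where $\Im$ is the right ideal generated by all $\partial e_C$ with $C$ a circuit, $|C|>1$, and by all $e_i$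 with $i$ a loop. Write $[X]$ for the class of $e_X$ in $\mathbb A$, and $\mathbb A_\ell$ for the image in $\mathbb A$ of the degree-$\ell$ component of $\mathfrak A$, i.e. the span of the classes $[X]$ with $|X|=\ell$. For $X=\{i_1<\dots<i_\ell\}$ and $\sigma\in\mathfrak S_\ell$ let $X^\sigma=(i_{\sigma(1)},\dots,i_{\sigma(\ell)})$, let $\chi(X^\sigma)=\mathrm{sgn}(\sigma)\chi(X)$, and let $\mathbf{Flag}(X^\sigma)$ be the sequence $$\mathrm{cl}\{i_{\sigma(\ell)}\}\subseteq\mathrm{cl}\{i_{\sigma(\ell)},i_{\sigma(\ell-1)}\}\subseteq\dots\subseteq\mathrm{cl}\{i_{\sigma(\ell)},\dots,i_{\sigma(1)}\};$$ put $\mathbf{Flag}(X)=\mathbf{Flag}(X^{\mathrm{id}})$. A broken circuit is a set $C\setminus\min C$ with $C$ a circuit, $|C|>1$; let $\mathrm{NBC}_\ell$ be the family of independent sets of size $\ell$ that contain no broken circuit. A family $\mathcal I$ of independent sets of size $\ell$, with a permutation $\sigma_I\in\mathfrak S_\ell$ for each $I\in\mathcal I$, is called a diagonal basis of $\mathbb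 A_\ell$ if $|\{[I]:I\in\mathcal I\}|\ge\dim\mathbb A_\ell$ and if, for all $I,J\in\mathcal I$ and $\tau\in\mathfrak S_\ell$, the equality $\mathbf{Flag}(J^\tau)=\mathbf{Flag}(I^{\sigma_I})$ implies $J=I$. Then: 1. $\mathrm{NBC}_\ell$, with $\sigma_I=\mathrm{id}$ for every $I$, is a diagonal basis of $\mathbb A_\ell$, and the classes $[I]$, $I\in\mathrm{NBC}_\ell$, form a basis of the vector space $\mathbb A_\ell$. 2. Let $J\subseteq[n]$, $|J|=\ell$, and $[J]=\sum_{I\in\mathrm{NBC}_\ell}\xi(I,J)\,[I]$ with $\xi(I,J)\in\mathbb K$. For every $I\in\mathrm{NBC}_\ell$, $\xi(I,J)\neq0$ if and only if $\mathbf{Flag}(I)=\mathbf{Flag}(J^\tau)$ for some $\tau\in\mathfrak S_\ell$; and for every such $\tau$, $\xi(I,J)=\chi(I)/\chi(J^\tau)$. 3. In particular, if $\beta_{i,j}=-1$ for all $i<j$, and $\chi(I)=1$ for $I$ independent, $\chi(X)=0$ for $X$ dependent (the Orlik–Solomon algebra, which is a $\chi$-algebra), then $\xi(I,J)=\mathrm{sgn}(\tau)$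 for every $\tau$ with $\mathbf{Flag}(I)=\mathbf{Flag}(J^\tau)$. -/

import Mathlib

namespace ChiAlg

section Algebra

variable {K : Type*} [Field K] {n : ℕ}

/-- The defining relations `eᵢ² = 0` and `eⱼ eᵢ = β i j • eᵢ eⱼ` for `i < j`. Only the values
`β i j` with `i < j` matter. -/
inductive SkewRel (β : Fin n → Fin n → K) :
    FreeAlgebra K (Fin n) → FreeAlgebra K (Fin n) → Prop
  | sq (i : Fin n) : SkewRel β (FreeAlgebra.ι K i * FreeAlgebra.ι K i) 0
  | comm (i j : Fin n) (hij : i < j) :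
      SkewRel β (FreeAlgebra.ι K j * FreeAlgebra.ι K i)
        (β i j • (FreeAlgebra.ι K i * FreeAlgebra.ι K j))

/-- The `K`-algebra `𝔸` generated by `e₁, …, eₙ` subject to the relations `SkewRel β`. -/
abbrev Skew (β : Fin n → Fin n → K) : Type _ := RingQuot (SkewRel β)

/-- The generator `eᵢ`. -/
noncomputable def gen (β : Fin n → Fin n → K) (i : Fin n) : Skew β :=
  RingQuot.mkAlgHom K (SkewRel β) (FreeAlgebra.ι K i)

/-- The monomial `e_X = e_{i₁} ⋯ e_{iₘ}` for `X = {i₁ < ⋯ < iₘ}`. -/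
noncomputable def mon (β : Fin n → Fin n → K) (X : Finset (Fin n)) : Skew β :=
  ((X.sort (· ≤ ·)).map (gen β)).prod

/-- The `χ`-boundary `∂ e_X = ∑ₚ (-1)ᵖ χ(X \ iₚ) e_{X \ iₚ}` for `X = {i₁ < ⋯ < iₘ}`, with the
convention `∂ eᵢ = 1` for singletons. The position `p` of `x` in `X` is `#{y ∈ X | y ≤ x}`. -/
noncomputable def boundary (β : Fin n → Fin n → K) (χ : Finset (Fin n) → K)
    (X : Finset (Fin n)) : Skew β :=
  if X.card = 1 then 1
  else ∑ x ∈ X, ((-1 : K) ^ (X.filter (· ≤ x)).card * χ (X.erase x)) • mon β (X.erase x)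

/-- `U` is unidependent: it contains a unique circuit. -/
def Unidependent (M : Matroid (Fin n)) (U : Finset (Fin n)) : Prop :=
  ∃! C : Set (Fin n), M.IsCircuit C ∧ C ⊆ (U : Set (Fin n))

/-- The conditions under which `β` and `χ` define a `χ`-algebra of the matroid `M`. -/
structure IsChiAlgebra (M : Matroid (Fin n)) (β : Fin n → Fin n → K)
    (χ : Finset (Fin n) → K) : Prop where
  beta_ne_zero : ∀ i j : Fin n, i < j → β i j ≠ 0
  chi_ne_zero_iff : ∀ I : Finset (Fin n), χ I ≠ 0 ↔ M.Indep (I : Set (Fin n))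
  boundary_eq : ∀ U U' : Finset (Fin n), Unidependent M U → Unidependent M U' → U' ⊆ U →
    ∃ ε : K, ε ≠ 0 ∧ boundary β χ U = ε • (boundary β χ U' * mon β (U \ U'))

/-- The right ideal of `𝔸` generated by the boundaries `∂ e_C` of the circuits `C` with `|C| > 1`
and by the loops. A right ideal is a submodule of `𝔸` over the opposite ring. -/
noncomputable def chiIdeal (M : Matroid (Fin n)) (β : Fin n → Fin n → K)
    (χ : Finset (Fin n) → K) : Submodule (Skew β)ᵐᵒᵖ (Skew β) :=
  Submodule.span (Skew β)ᵐᵒᵖ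
    ({a | ∃ C : Finset (Fin n), M.IsCircuit (C : Set (Fin n)) ∧ 1 < C.card ∧
        a = boundary β χ C} ∪
     {a | ∃ i : Fin n, M.IsCircuit {i} ∧ a = gen β i})

/-- The `χ`-algebra `𝔸 / ℑ_χ(M)`, with its structure of a `K`-vector space. -/
abbrev ChiAlgebra (M : Matroid (Fin n)) (β : Fin n → Fin n → K)
    (χ : Finset (Fin n) → K) : Type _ :=
  Skew β ⧸ (chiIdeal M β χ).restrictScalars K

/-- The residue class `[X]` of the monomial `e_X`. -/
noncomputable def cls (M : Matroid (Fin n)) (β : Fin n → Fin n → K)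
    (χ : Finset (Fin n) → K) (X : Finset (Fin n)) : ChiAlgebra M β χ :=
  ((chiIdeal M β χ).restrictScalars K).mkQ (mon β X)

/-- The homogeneous component of degree `ℓ` of `𝔸`. -/
noncomputable def skewDeg (β : Fin n → Fin n → K) (ℓ : ℕ) : Submodule K (Skew β) :=
  Submodule.span K {a | ∃ X : Finset (Fin n), X.card = ℓ ∧ a = mon β X}

/-- The homogeneous component of degree `ℓ` of the `χ`-algebra, as a subspace. -/
noncomputable def chiDeg (M : Matroid (Fin n)) (β : Fin n → Fin n → K)
    (χ : Finset (Fin n) → K) (ℓ : ℕ) : Submodule K (ChiAlgebra M β χ) :=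
  (skewDeg β ℓ).map ((chiIdeal M β χ).restrictScalars K).mkQ

/-- The subsets of `[n]` of size `ℓ`. -/
abbrev Subsets (n ℓ : ℕ) : Type := {X : Finset (Fin n) // X.card = ℓ}

/-- The ordered set `X^σ = (i_{σ(1)}, …, i_{σ(ℓ)})` for `X = {i₁ < ⋯ < i_ℓ}`. -/
def ordered {ℓ : ℕ} (X : Subsets n ℓ) (σ : Equiv.Perm (Fin ℓ)) : Fin ℓ → Fin n :=
  fun k => X.1.orderEmbOfFin X.2 (σ k)

/-- The extension `χ(X^σ) = sgn(σ) χ(X)` of `χ` to ordered sets. -/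
def chiOrd {ℓ : ℕ} (χ : Finset (Fin n) → K) (X : Subsets n ℓ) (σ : Equiv.Perm (Fin ℓ)) : K :=
  ((Equiv.Perm.sign σ : ℤ) : K) * χ X.1

/-- The flag of flats of the ordered set `X^σ`, built from its last element on:
`cl {i_{σ(ℓ)}}, cl {i_{σ(ℓ)}, i_{σ(ℓ-1)}}, …, cl {i_{σ(ℓ)}, …, i_{σ(1)}}`. -/
def flag (M : Matroid (Fin n)) {ℓ : ℕ} (X : Subsets n ℓ) (σ : Equiv.Perm (Fin ℓ)) :
    Fin ℓ → Set (Fin n) :=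
  fun k => M.closure {x | ∃ j : Fin ℓ, k.rev ≤ j ∧ x = ordered X σ j}

/-- A broken circuit: a circuit with at least two elements, with its smallest element deleted. -/
def IsBrokenCircuit (M : Matroid (Fin n)) (B : Finset (Fin n)) : Prop :=
  ∃ C : Finset (Fin n), M.IsCircuit (C : Set (Fin n)) ∧ 1 < C.card ∧
    ∃ α ∈ C, (∀ y ∈ C, α ≤ y) ∧ B = C.erase α

open Classical in
/-- The no broken circuit sets of size `ℓ`. -/
noncomputable def nbc (M : Matroid (Fin n)) (ℓ : ℕ) : Finset (Subsets n ℓ) :=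
  Finset.univ.filter fun I =>
    M.Indep (I.1 : Set (Fin n)) ∧ ∀ B : Finset (Fin n), IsBrokenCircuit M B → ¬ B ⊆ I.1

/-- A family `𝓘` of independent sets of size `ℓ`, with an ordering `σ I` of each of its members
`I`, is a diagonal basis of the degree `ℓ` component: it has at least as many residue classes as
the dimension, and a member `J` of which some ordering has the flag of `I^{σ I}` equals `I`. -/
structure IsDiagonalBasis (M : Matroid (Fin n)) (β : Fin n → Fin n → K)
    (χ : Finset (Fin n) → K) (ℓ : ℕ) (𝓘 : Finset (Subsets n ℓ))
    (σ : Subsets n ℓ → Equiv.Perm (Fin ℓ)) : Prop where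
  indep : ∀ I ∈ 𝓘, M.Indep (I.1 : Set (Fin n))
  finrank_le : Module.finrank K (chiDeg M β χ ℓ) ≤
    ((fun I : Subsets n ℓ => cls M β χ I.1) '' (𝓘 : Set (Subsets n ℓ))).ncard
  eq_of_flag_eq : ∀ I ∈ 𝓘, ∀ J ∈ 𝓘, ∀ τ : Equiv.Perm (Fin ℓ),
    flag M J τ = flag M I (σ I) → J = I

/-- The commutation constants `-1` of the exterior algebra. -/
def osBeta (K : Type*) [Field K] (n : ℕ) : Fin n → Fin n → K := fun _ _ => -1

open Classical in
/-- The map `χ` of the Orlik–Solomon algebra: `1` on independent sets and `0` on dependent sets. -/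
noncomputable def osChi (K : Type*) [Field K] (M : Matroid (Fin n)) : Finset (Fin n) → K :=
  fun X => if M.Indep (X : Set (Fin n)) then 1 else 0

end Algebra

end ChiAlg

/-! For each NBC set `I` there is a linear form on the `χ`-algebra, an iterated residue along the
flag of `I`, that reads off the coefficient of `[I]`. The flag cuts the nonloops of its largest flat
into disjoint slots, the differences of consecutive flats. By the exchange property, `J^τ` has the
flag of the independent set `I` exactly when its `p`-th entry lies in the `p`-th slot for every `p`
(`tail_eq_iff_mem_slot`). Such a `τ` is unique, so the incidence matrix between `J` and the slots
has determinant `sgn τ`, or `0` if there is no `τ`. The residue sends `e_J` to this determinant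
divided by `χ J`.

It vanishes on the ideal: in `∂ e_U` the factors `χ` cancel, leaving up to sign the Laplace
expansion of a determinant whose first column, all ones, is the sum of the slot columns
(`sum_slotDet_erase`). Condition (ii) carries this over to the products `∂ e_C * e_Y`
(`skewResidue_boundary_mul_mon`).

No other NBC set has an ordering with the flag of `I` (`eq_of_mem_nbc_of_mem_slot`), so the residues
are dual, up to the factors `χ I`, to the NBC classes. This gives linear independence and the
coefficient formula. Spanning is straightening: a broken circuit is traded for smaller elements
(`cls_mem_nbcSpan`). -/

namespace ChiAlg

/-! ### Monomial basis of the skew algebra. -/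

section SkewAlgebra

variable {K : Type*} [Field K] {n : ℕ} (β : Fin n → Fin n → K)

/-- The scalar picked up when `e_X e_Y` is sorted into `e_{X ∪ Y}`, for disjoint `X` and `Y`. -/
def crossing (X Y : Finset (Fin n)) : K := ∏ x ∈ X, ∏ y ∈ Y with y < x, β y x

lemma crossing_singleton (i : Fin n) (X : Finset (Fin n)) :
    crossing β {i} X = ∏ y ∈ X with y < i, β y i := by
  simp [crossing]

variable {β} in
lemma crossing_ne_zero (hβ : ∀ i j : Fin n, i < j → β i j ≠ 0) (X Y : Finset (Fin n)) :
    crossing β X Y ≠ 0 :=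
  Finset.prod_ne_zero_iff.2 fun _ _ => Finset.prod_ne_zero_iff.2 fun _ hy =>
    hβ _ _ (Finset.mem_filter.1 hy).2

lemma gen_mul_self (i : Fin n) : gen β i * gen β i = 0 := by
  rw [gen, ← map_mul, RingQuot.mkAlgHom_rel K (SkewRel.sq i), map_zero]

lemma gen_mul_gen {i j : Fin n} (hij : i < j) :
    gen β j * gen β i = β i j • (gen β i * gen β j) := by
  rw [gen, gen, ← map_mul, RingQuot.mkAlgHom_rel K (SkewRel.comm i j hij), map_smul, map_mul]

lemma mon_empty : mon β ∅ = 1 := by simp [mon]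

lemma mon_insert_of_lt {a : Fin n} {X : Finset (Fin n)} (h : ∀ x ∈ X, a < x) :
    mon β (insert a X) = gen β a * mon β X := by
  rw [mon, Finset.sort_insert _ (fun x hx => (h x hx).le) (fun ha => lt_irrefl _ (h a ha))]
  simp [mon]

lemma mon_singleton (i : Fin n) : mon β {i} = gen β i := by simp [mon]

lemma gen_mul_mon (i : Fin n) (X : Finset (Fin n)) :
    gen β i * mon β X = if i ∈ X then 0 else crossing β {i} X • mon β (insert i X) := by
  induction X using Finset.induction_on_min with
  | empty => simp [mon_empty, crossing, mon_singleton]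
  | insert a X ha ih =>
    have haX : a ∉ X := fun h => lt_irrefl _ (ha a h)
    rcases lt_trichotomy i a with hia | rfl | hai
    · have hlt : ∀ x ∈ insert a X, i < x := by
        intro x hx
        rcases Finset.mem_insert.1 hx with rfl | hx
        exacts [hia, hia.trans (ha x hx)]
      have hi : i ∉ insert a X := fun h => lt_irrefl _ (hlt i h)
      have hf : (insert a X).filter (· < i) = ∅ :=
        Finset.filter_eq_empty_iff.2 fun x hx => (hlt x hx).not_gt
      rw [if_neg hi, crossing_singleton, hf, Finset.prod_empty, one_smul,
        mon_insert_of_lt β hlt]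
    · rw [mon_insert_of_lt β ha, ← mul_assoc, gen_mul_self]
      simp
    · rw [mon_insert_of_lt β ha, ← mul_assoc, gen_mul_gen β hai, smul_mul_assoc, mul_assoc, ih]
      by_cases hi : i ∈ X
      · simp [hi]
      · have hi' : i ∉ insert a X := by simp [hi, hai.ne']
        have hlt : ∀ x ∈ insert i X, a < x := by
          intro x hx
          rcases Finset.mem_insert.1 hx with rfl | hx
          exacts [hai, ha x hx]
        rw [if_neg hi, if_neg hi', mul_smul_comm, ← mon_insert_of_lt β hlt, smul_smul,
          Finset.insert_comm, crossing_singleton, crossing_singleton, Finset.filter_insert,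
          if_pos hai, Finset.prod_insert (by simp [haX])]

lemma mon_mul_mon (X Y : Finset (Fin n)) :
    mon β X * mon β Y = if Disjoint X Y then crossing β X Y • mon β (X ∪ Y) else 0 := by
  induction X using Finset.induction_on_min with
  | empty => simp [mon_empty, crossing]
  | insert a X ha ih =>
    have haX : a ∉ X := fun h => lt_irrefl _ (ha a h)
    rw [mon_insert_of_lt β ha, mul_assoc, ih]
    simp only [Finset.disjoint_insert_left]
    by_cases hd : Disjoint X Y
    · rw [if_pos hd, mul_smul_comm, gen_mul_mon]
      by_cases haY : a ∈ Y
      · simp [haY]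
      · have hf : (X ∪ Y).filter (· < a) = Y.filter (· < a) := by
          rw [Finset.filter_union, Finset.filter_eq_empty_iff.2 fun x hx => (ha x hx).not_gt,
            Finset.empty_union]
        rw [if_neg (by simp [haX, haY]), if_pos ⟨haY, hd⟩, smul_smul, Finset.insert_union,
          crossing_singleton, hf, crossing, crossing, Finset.prod_insert haX, mul_comm]
    · simp [hd]

lemma mon_mul_mon_of_disjoint {X Y : Finset (Fin n)} (h : Disjoint X Y) :
    mon β X * mon β Y = crossing β X Y • mon β (X ∪ Y) := by
  rw [mon_mul_mon, if_pos h]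

lemma mon_mul_mon_of_not_disjoint {X Y : Finset (Fin n)} (h : ¬ Disjoint X Y) :
    mon β X * mon β Y = 0 := by
  rw [mon_mul_mon, if_neg h]

lemma span_range_mon : Submodule.span K (Set.range (mon β)) = ⊤ := by
  rw [eq_top_iff]
  rintro a -
  obtain ⟨x, rfl⟩ := RingQuot.mkAlgHom_surjective K (SkewRel β) a
  induction x using FreeAlgebra.induction with
  | grade0 r =>
    rw [AlgHom.commutes, Algebra.algebraMap_eq_smul_one, ← mon_empty]
    exact Submodule.smul_mem _ _ (Submodule.subset_span ⟨∅, rfl⟩)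
  | grade1 i => exact Submodule.subset_span ⟨{i}, mon_singleton β i⟩
  | mul x y hx hy =>
    rw [map_mul]
    refine (?_ : Submodule.span K (Set.range (mon β)) * Submodule.span K (Set.range (mon β)) ≤
      Submodule.span K (Set.range (mon β))) (Submodule.mul_mem_mul hx hy)
    rw [Submodule.span_mul_span, Submodule.span_le]
    rintro _ ⟨_, ⟨X, rfl⟩, _, ⟨Y, rfl⟩, rfl⟩
    change mon β X * mon β Y ∈ _
    rw [mon_mul_mon]
    split_ifs
    · exact Submodule.smul_mem _ _ (Submodule.subset_span ⟨_, rfl⟩)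
    · exact Submodule.zero_mem _
  | add x y hx hy => rw [map_add]; exact Submodule.add_mem _ hx hy

/-- Left multiplication by `eᵢ` on the vector space with basis the subsets of `[n]`. -/
noncomputable def creation (i : Fin n) : Module.End K (Finset (Fin n) →₀ K) :=
  Finsupp.linearCombination K fun X =>
    if i ∈ X then 0 else Finsupp.single (insert i X) (crossing β {i} X)

lemma creation_single (i : Fin n) (X : Finset (Fin n)) (r : K) :
    creation β i (Finsupp.single X r) =
      r • if i ∈ X then 0 else Finsupp.single (insert i X) (crossing β {i} X) := by
  simp [creation]

lemma creation_mul_self (i : Fin n) : creation β i * creation β i = 0 := by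
  refine Finsupp.lhom_ext fun X r => ?_
  rw [Module.End.mul_apply, creation_single]
  split_ifs with h
  · simp
  · rw [map_smul, creation_single]
    simp

lemma creation_mul_creation {i j : Fin n} (hij : i < j) :
    creation β j * creation β i = β i j • (creation β i * creation β j) := by
  refine Finsupp.lhom_ext fun X r => ?_
  rw [LinearMap.smul_apply, Module.End.mul_apply, Module.End.mul_apply, creation_single,
    creation_single]
  by_cases hi : i ∈ X <;> by_cases hj : j ∈ X <;>
    simp only [hi, hj, if_true, if_false, smul_zero, map_zero, map_smul, creation_single,
      Finset.mem_insert, or_true, or_false, hij.ne, hij.ne']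
  have h1 : crossing β {j} (insert i X) = β i j * crossing β {j} X := by
    rw [crossing_singleton, crossing_singleton, Finset.filter_insert, if_pos hij,
      Finset.prod_insert (by simp [hi])]
  have h2 : crossing β {i} (insert j X) = crossing β {i} X := by
    rw [crossing_singleton, crossing_singleton, Finset.filter_insert, if_neg hij.not_gt]
  rw [h1, h2, Finset.insert_comm]
  simp only [Finsupp.smul_single, smul_eq_mul]
  congr 1
  ring

/-- The regular representation of the skew algebra, in the basis of the monomials. -/
noncomputable def regRep : Skew β →ₐ[K] Module.End K (Finset (Fin n) →₀ K) :=
  RingQuot.liftAlgHom K ⟨FreeAlgebra.lift K (creation β), by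
    intro x y h
    cases h with
    | sq i => simp [creation_mul_self]
    | comm i j hij => simp [creation_mul_creation β hij]⟩

lemma regRep_gen (i : Fin n) : regRep β (gen β i) = creation β i := by
  simp [regRep, gen, RingQuot.liftAlgHom_mkAlgHom_apply]

/-- Acting on the basis vector of `∅` separates the monomials, so they are linearly independent and
a linear form may be prescribed on them freely. -/
lemma regRep_mon (X : Finset (Fin n)) :
    regRep β (mon β X) (Finsupp.single ∅ 1) = Finsupp.single X 1 := by
  induction X using Finset.induction_on_min with
  | empty => simp [mon_empty]
  | insert a X ha ih =>
    have haX : a ∉ X := fun h => lt_irrefl _ (ha a h)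
    rw [mon_insert_of_lt β ha, map_mul, Module.End.mul_apply, ih, regRep_gen, creation_single,
      if_neg haX, one_smul, crossing_singleton,
      Finset.filter_eq_empty_iff.2 fun x hx => (ha x hx).not_gt, Finset.prod_empty]

/-- The linear form on the skew algebra with prescribed values on the monomials. -/
noncomputable def monForm (g : Finset (Fin n) → K) : Skew β →ₗ[K] K :=
  Finsupp.linearCombination K g ∘ₗ
    LinearMap.applyₗ (Finsupp.single ∅ 1) ∘ₗ (regRep β).toLinearMap

lemma monForm_mon (g : Finset (Fin n) → K) (X : Finset (Fin n)) :
    monForm β g (mon β X) = g X := by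
  simp [monForm, regRep_mon]

end SkewAlgebra

/-! ### Flags of flats and their slots. -/

section Flags

variable {n ℓ : ℕ} (M : Matroid (Fin n)) (f g : Fin ℓ → Fin n)

/-- The closure of the entries of an ordered set from position `k` on. -/
def tail (k : ℕ) : Set (Fin n) := M.closure (f '' {j | k ≤ (j : ℕ)})

/-- The elements which the flag of an ordered set acquires with its entry at position `p`. -/
def slot (p : Fin ℓ) : Set (Fin n) := tail M f p \ tail M f (p + 1)

lemma flag_eq_tail (X : Subsets n ℓ) (σ : Equiv.Perm (Fin ℓ)) (k : Fin ℓ) :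
    flag M X σ k = tail M (ordered X σ) k.rev := by
  rw [flag, tail]
  congr 1
  ext x
  simp only [Set.mem_ofPred_eq, Set.mem_image, Fin.le_def, eq_comm]

lemma flag_eq_flag_iff (X Y : Subsets n ℓ) (σ τ : Equiv.Perm (Fin ℓ)) :
    flag M X σ = flag M Y τ ↔ ∀ p : Fin ℓ, tail M (ordered X σ) p = tail M (ordered Y τ) p := by
  simp only [funext_iff, flag_eq_tail]
  exact ⟨fun h p => by simpa using h p.rev, fun h p => h p.rev⟩

lemma tail_of_le {k : ℕ} (h : ℓ ≤ k) : tail M f k = M.closure ∅ := by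
  have : {j : Fin ℓ | k ≤ (j : ℕ)} = ∅ := by
    ext j; simpa using j.2.trans_le h
  rw [tail, this, Set.image_empty]

lemma tail_zero : tail M f 0 = M.closure (Set.range f) := by
  simp [tail]

lemma tail_anti {k m : ℕ} (h : k ≤ m) : tail M f m ⊆ tail M f k :=
  M.closure_subset_closure (Set.image_mono fun _ hj => h.trans hj)

lemma image_from_eq_insert (p : Fin ℓ) :
    f '' {j | (p : ℕ) ≤ (j : ℕ)} = insert (f p) (f '' {j | (p : ℕ) + 1 ≤ (j : ℕ)}) := by
  rw [← Set.image_insert_eq]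
  congr 1
  ext j
  simp only [Set.mem_ofPred_eq, Set.mem_insert_iff, Fin.ext_iff]
  omega

lemma tail_eq_closure_insert (p : Fin ℓ) :
    tail M f p = M.closure (insert (f p) (tail M f (p + 1))) := by
  rw [tail, tail, M.closure_insert_closure_eq_closure_insert, image_from_eq_insert]

variable {M f g}

lemma mem_tail (hE : M.E = Set.univ) {p : Fin ℓ} {k : ℕ} (h : k ≤ p) : f p ∈ tail M f k :=
  M.subset_closure _ (by simp [hE]) ⟨p, h, rfl⟩

lemma slot_unique {x : Fin n} {p q : Fin ℓ} (hp : x ∈ slot M f p) (hq : x ∈ slot M f q) :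
    p = q := by
  by_contra hne
  rcases lt_or_gt_of_ne hne with h | h
  · exact hp.2 (tail_anti M f (Nat.succ_le_of_lt h) hq.1)
  · exact hq.2 (tail_anti M f (Nat.succ_le_of_lt h) hp.1)

/-- The tails shrink from the full closure down to the set of loops, so `x` drops out at some first
stage. -/
lemma exists_mem_slot {x : Fin n} (hx : x ∈ tail M f 0) (hx0 : x ∉ M.closure ∅) :
    ∃ p, x ∈ slot M f p := by
  classical
  have hex : ∃ k, x ∉ tail M f k := ⟨ℓ, by rwa [tail_of_le M f le_rfl]⟩
  have h1 := Nat.find_spec hex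
  have hpos : Nat.find hex ≠ 0 := fun h => by rw [h] at h1; exact h1 hx
  obtain ⟨k, hk⟩ := Nat.exists_eq_succ_of_ne_zero hpos
  have h2 : x ∈ tail M f k := not_not.1 (Nat.find_min hex (by omega))
  have hkl : k < ℓ := by
    by_contra h
    exact hx0 (by rwa [tail_of_le M f (not_lt.1 h)] at h2)
  exact ⟨⟨k, hkl⟩, h2, by rwa [hk] at h1⟩

lemma tail_congr (h : ∀ p : Fin ℓ, tail M g p = tail M f p) (k : ℕ) :
    tail M g k = tail M f k := by
  rcases lt_or_ge k ℓ with hk | hk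
  · exact h ⟨k, hk⟩
  · rw [tail_of_le M f hk, tail_of_le M g hk]

lemma mem_slot_self (hE : M.E = Set.univ) (hf : ∀ p : Fin ℓ, f p ∉ tail M f (p + 1))
    (p : Fin ℓ) : f p ∈ slot M f p :=
  ⟨mem_tail hE le_rfl, hf p⟩

/-- By the exchange property, any element of a slot generates the same flat over the next tail as
the original entry does. -/
lemma tail_eq_of_mem_slot (h : ∀ p, g p ∈ slot M f p) (k : ℕ) : tail M g k = tail M f k := by
  refine tail_congr (fun p => ?_) k
  -- Flags grow from the last entry on, so the induction runs on the distance `d` of `p` from the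
  -- last position.
  obtain ⟨d, hd⟩ : ∃ d, (p : ℕ) + d + 1 = ℓ := ⟨ℓ - p - 1, by omega⟩
  induction d generalizing p with
  | zero =>
    have hs := h p
    rw [slot, tail_eq_closure_insert M f p, tail_of_le M f (k := p + 1) (by omega)] at hs
    rw [tail_eq_closure_insert M f p, tail_eq_closure_insert M g p,
      tail_of_le M f (k := p + 1) (by omega), tail_of_le M g (k := p + 1) (by omega)]
    exact M.closure_insert_congr (by simpa using hs)
  | succ d ih =>
    have hs := h p
    have hp := ih ⟨p + 1, by omega⟩ (by simp only; omega)
    simp only at hp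
    rw [slot, tail_eq_closure_insert M f p] at hs
    rw [tail_eq_closure_insert M f p, tail_eq_closure_insert M g p, hp]
    refine M.closure_insert_congr ⟨hs.1, ?_⟩
    rw [tail, M.closure_closure]
    exact hs.2

lemma tail_eq_iff_mem_slot (hE : M.E = Set.univ) (hf : ∀ p : Fin ℓ, f p ∉ tail M f (p + 1)) :
    (∀ p : Fin ℓ, tail M g p = tail M f p) ↔ ∀ p, g p ∈ slot M f p := by
  refine ⟨fun h p => ⟨h p ▸ mem_tail hE le_rfl, fun hp => hf p ?_⟩,
    fun h p => tail_eq_of_mem_slot h p⟩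
  -- If `g p` already lay in the next tail, the flag would not grow at `p`, and `f p` would lie in
  -- that tail too.
  rw [← tail_congr h] at hp ⊢
  have := tail_eq_closure_insert M g p
  rw [Set.insert_eq_of_mem hp, h p, tail, tail, M.closure_closure] at this
  rw [tail, ← this]
  exact mem_tail hE le_rfl

lemma notMem_tail_of_indep (hinj : Function.Injective f)
    (hi : M.Indep (Set.range f)) (p : Fin ℓ) : f p ∉ tail M f (p + 1) := by
  intro h
  refine hi.notMem_closure_sdiff_of_mem ⟨p, rfl⟩ (M.closure_subset_closure ?_ h)
  rintro _ ⟨j, hj, rfl⟩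
  refine ⟨⟨j, rfl⟩, fun hjp => ?_⟩
  have := congrArg Fin.val (hinj hjp)
  simp only [Set.mem_ofPred_eq] at hj
  omega

lemma indep_range_of_notMem_tail (hE : M.E = Set.univ)
    (hf : ∀ p : Fin ℓ, f p ∉ tail M f (p + 1)) : M.Indep (Set.range f) := by
  have key : ∀ d k, k + d = ℓ → M.Indep (f '' {j | k ≤ (j : ℕ)}) := by
    intro d
    induction d with
    | zero =>
      intro k hk
      have : {j : Fin ℓ | k ≤ (j : ℕ)} = ∅ := by
        ext j; simp only [Set.mem_ofPred_eq, Set.mem_empty_iff_false, iff_false]; omega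
      rw [this, Set.image_empty]
      exact M.empty_indep
    | succ d ih =>
      intro k hk
      have := image_from_eq_insert f ⟨k, by omega⟩
      simp only at this
      rw [this, Matroid.insert_indep_iff]
      exact ⟨ih (k + 1) (by omega), fun _ => ⟨by simp [hE], hf ⟨k, by omega⟩⟩⟩
  simpa using key ℓ 0 (zero_add _)

end Flags

/-! ### Orderings of a set as transversals of the slots. -/

section Ordered

variable {n ℓ : ℕ} {M : Matroid (Fin n)}

lemma ordered_injective (X : Subsets n ℓ) (σ : Equiv.Perm (Fin ℓ)) :
    Function.Injective (ordered X σ) :=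
  (X.1.orderEmbOfFin X.2).injective.comp σ.injective

lemma range_ordered (X : Subsets n ℓ) (σ : Equiv.Perm (Fin ℓ)) :
    Set.range (ordered X σ) = (X.1 : Set (Fin n)) := by
  have : ordered X σ = X.1.orderEmbOfFin X.2 ∘ σ := rfl
  rw [this, σ.surjective.range_comp, Finset.range_orderEmbOfFin]

lemma ordered_notMem_tail (X : Subsets n ℓ) (σ : Equiv.Perm (Fin ℓ))
    (hX : M.Indep (X.1 : Set (Fin n))) (p : Fin ℓ) :
    ordered X σ p ∉ tail M (ordered X σ) (p + 1) :=
  notMem_tail_of_indep (ordered_injective X σ) (by rwa [range_ordered]) p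

lemma indep_of_mem_slot (hE : M.E = Set.univ) {f : Fin ℓ → Fin n} (X : Subsets n ℓ)
    {σ : Equiv.Perm (Fin ℓ)} (h : ∀ p, ordered X σ p ∈ slot M f p) :
    M.Indep (X.1 : Set (Fin n)) := by
  rw [← range_ordered X σ]
  refine indep_range_of_notMem_tail hE fun p => ?_
  rw [tail_eq_of_mem_slot h]
  exact (h p).2

lemma flag_eq_flag_iff_mem_slot (hE : M.E = Set.univ) {I : Subsets n ℓ}
    (hI : M.Indep (I.1 : Set (Fin n))) (σ : Equiv.Perm (Fin ℓ)) (J : Subsets n ℓ)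
    (τ : Equiv.Perm (Fin ℓ)) :
    flag M I σ = flag M J τ ↔ ∀ p, ordered J τ p ∈ slot M (ordered I σ) p := by
  rw [eq_comm, flag_eq_flag_iff, tail_eq_iff_mem_slot hE (ordered_notMem_tail I σ hI)]

lemma perm_eq_of_mem_slot {f : Fin ℓ → Fin n} (X : Subsets n ℓ) {σ τ : Equiv.Perm (Fin ℓ)}
    (hσ : ∀ p, ordered X σ p ∈ slot M f p) (hτ : ∀ p, ordered X τ p ∈ slot M f p) : σ = τ := by
  ext p : 1
  have h1 := hτ (τ.symm (σ p))
  have h2 : ordered X τ (τ.symm (σ p)) = ordered X σ p := by simp [ordered]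
  rw [h2] at h1
  have := slot_unique (hσ p) h1
  rw [Equiv.eq_symm_apply] at this
  exact this.symm

end Ordered

/-! ### The slot determinant and its alternating sum. -/

section SlotDet

variable (K : Type*) [Field K] {n ℓ : ℕ} (M : Matroid (Fin n)) (f : Fin ℓ → Fin n)

open Classical in
/-- The determinant of the incidence matrix between the elements of `X` and the slots of an
ordered set. -/
noncomputable def slotDet (X : Finset (Fin n)) : K :=
  if h : X.card = ℓ then
    Matrix.det (Matrix.of fun i p : Fin ℓ => if X.orderEmbOfFin h i ∈ slot M f p then (1 : K) else 0)
  else 0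

open Classical in
lemma slotDet_eq_sum (X : Subsets n ℓ) :
    slotDet K M f X.1 = ∑ σ : Equiv.Perm (Fin ℓ),
      if ∀ p, ordered X σ p ∈ slot M f p then ((Equiv.Perm.sign σ : ℤ) : K) else 0 := by
  rw [slotDet, dif_pos X.2, Matrix.det_apply']
  refine Finset.sum_congr rfl fun σ _ => ?_
  simp only [Matrix.of_apply]
  split_ifs with h
  · rw [Finset.prod_eq_one, mul_one]
    exact fun p _ => if_pos (h p)
  · push Not at h
    obtain ⟨p, hp⟩ := h
    rw [Finset.prod_eq_zero (Finset.mem_univ p), mul_zero]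
    exact if_neg hp

variable {M f}

/-- The slots are disjoint, so only one permutation contributes to the Leibniz sum. -/
lemma slotDet_of_mem_slot (X : Subsets n ℓ) {τ : Equiv.Perm (Fin ℓ)}
    (h : ∀ p, ordered X τ p ∈ slot M f p) :
    slotDet K M f X.1 = ((Equiv.Perm.sign τ : ℤ) : K) := by
  classical
  rw [slotDet_eq_sum, Finset.sum_eq_single τ, if_pos h]
  · exact fun σ _ hσ => if_neg fun h' => hσ (perm_eq_of_mem_slot X h' h)
  · simp

variable {K} in
lemma exists_mem_slot_of_slotDet_ne_zero (X : Subsets n ℓ) (h : slotDet K M f X.1 ≠ 0) :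
    ∃ τ : Equiv.Perm (Fin ℓ), ∀ p, ordered X τ p ∈ slot M f p := by
  classical
  rw [slotDet_eq_sum] at h
  obtain ⟨τ, -, hτ⟩ := Finset.exists_ne_zero_of_sum_ne_zero h
  exact ⟨τ, by by_contra h'; exact hτ (if_neg h')⟩

lemma card_filter_le_orderEmbOfFin (U : Finset (Fin n)) {m : ℕ} (hU : U.card = m) (i : Fin m) :
    (U.filter (· ≤ U.orderEmbOfFin hU i)).card = i + 1 := by
  have : U.filter (· ≤ U.orderEmbOfFin hU i) =
      (Finset.Iic i).map (U.orderEmbOfFin hU).toEmbedding := by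
    ext x
    simp only [Finset.mem_filter, Finset.mem_map, Finset.mem_Iic, RelEmbedding.coe_toEmbedding]
    constructor
    · rintro ⟨hx, hle⟩
      have : x ∈ Set.range (U.orderEmbOfFin hU) := by rwa [Finset.range_orderEmbOfFin]
      obtain ⟨j, rfl⟩ := this
      exact ⟨j, by simpa using hle, rfl⟩
    · rintro ⟨j, hj, rfl⟩
      exact ⟨Finset.orderEmbOfFin_mem _ _ _, by simpa using hj⟩
  rw [this, Finset.card_map, Fin.card_Iic]

lemma sum_slotDet_erase_of_forall_mem_slot {U : Finset (Fin n)} (hU : U.card = ℓ + 1)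
    (h : ∀ x ∈ U, ∃ p, x ∈ slot M f p) :
    ∑ x ∈ U, (-1 : K) ^ (U.filter (· ≤ x)).card * slotDet K M f (U.erase x) = 0 := by
  classical
  set u := U.orderEmbOfFin hU with hu
  -- Every row has exactly one slot entry equal to `1`, so the added column of ones is the sum of
  -- the slot columns, and `(1, -1, …, -1)` lies in the kernel.
  set A : Matrix (Fin (ℓ + 1)) (Fin (ℓ + 1)) K := Matrix.of fun i =>
    Fin.cons 1 fun p : Fin ℓ => if u i ∈ slot M f p then (1 : K) else 0 with hA
  have hdet : A.det = 0 := by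
    rw [← Matrix.exists_mulVec_eq_zero_iff]
    refine ⟨Fin.cons 1 fun _ => -1, fun h0 => one_ne_zero (congrFun h0 0), ?_⟩
    ext i
    obtain ⟨p, hp⟩ := h (u i) (Finset.orderEmbOfFin_mem _ _ _)
    have : ∑ q : Fin ℓ, (if u i ∈ slot M f q then (1 : K) else 0) = 1 := by
      rw [Finset.sum_eq_single p, if_pos hp]
      · exact fun q _ hq => if_neg fun h' => hq (slot_unique h' hp)
      · simp
    simp [Matrix.mulVec, dotProduct, Fin.sum_univ_succ, hA, this]
  have hsum : ∀ F : Fin n → K, ∑ x ∈ U, F x = ∑ i, F (u i) := by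
    intro F
    conv_lhs => rw [← Finset.map_orderEmbOfFin_univ U hU]
    rw [Finset.sum_map]
    rfl
  -- Positions in `U` count from `1` and matrix rows from `0`, so the sum is minus the determinant.
  rw [hsum, ← neg_eq_zero, ← hdet, Matrix.det_succ_column_zero, ← Finset.sum_neg_distrib]
  refine Finset.sum_congr rfl fun i _ => ?_
  have hc : (U.erase (u i)).card = ℓ := by
    rw [Finset.card_erase_of_mem (Finset.orderEmbOfFin_mem _ _ _), hU, Nat.add_sub_cancel]
  have hemb : u ∘ i.succAbove = (U.erase (u i)).orderEmbOfFin hc :=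
    Finset.orderEmbOfFin_unique hc
      (fun j => Finset.mem_erase.2 ⟨fun hj => Fin.succAbove_ne i j (u.injective hj),
        Finset.orderEmbOfFin_mem _ _ _⟩)
      (u.strictMono.comp (Fin.strictMono_succAbove i))
  have hsub : A.submatrix i.succAbove Fin.succ = Matrix.of fun k p : Fin ℓ =>
      if (U.erase (u i)).orderEmbOfFin hc k ∈ slot M f p then (1 : K) else 0 := by
    ext k p
    simp [hA, ← hemb]
  rw [card_filter_le_orderEmbOfFin, slotDet, dif_pos hc, hsub, pow_succ]
  simp [hA]

/-- If some term is nonzero, `U.erase x` is a transversal of the slots. The nonloop `x` lies in its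
closure, hence in a slot as well, and the singular matrix argument applies to all of `U`. -/
lemma sum_slotDet_erase (hE : M.E = Set.univ) {U : Finset (Fin n)} (hU : U.card = ℓ + 1)
    (h : ∀ x ∈ U, M.Indep (U.erase x : Set (Fin n)) →
      x ∈ M.closure (U.erase x : Set (Fin n)) ∧ x ∉ M.closure ∅) :
    ∑ x ∈ U, (-1 : K) ^ (U.filter (· ≤ x)).card * slotDet K M f (U.erase x) = 0 := by
  by_cases h0 : ∀ x ∈ U, slotDet K M f (U.erase x) = 0
  · exact Finset.sum_eq_zero fun x hx => by rw [h0 x hx, mul_zero]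
  push Not at h0
  obtain ⟨x, hx, hne⟩ := h0
  have hc : (U.erase x).card = ℓ := by rw [Finset.card_erase_of_mem hx, hU, Nat.add_sub_cancel]
  obtain ⟨τ, hτ⟩ := exists_mem_slot_of_slotDet_ne_zero ⟨U.erase x, hc⟩ hne
  have hx' := h x hx (indep_of_mem_slot hE ⟨U.erase x, hc⟩ hτ)
  refine sum_slotDet_erase_of_forall_mem_slot K hU fun y hy => ?_
  by_cases hyx : y = x
  · subst hyx
    refine exists_mem_slot ?_ hx'.2
    rw [← tail_eq_of_mem_slot hτ, tail_zero, range_ordered]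
    exact hx'.1
  · have : y ∈ Set.range (ordered ⟨U.erase x, hc⟩ τ) := by
      rw [range_ordered]
      simp [hyx, hy]
    obtain ⟨p, rfl⟩ := this
    exact ⟨p, hτ p⟩

end SlotDet

/-! ### NBC sets are determined by their flags. -/

section NoBrokenCircuit

variable {n ℓ : ℕ} {M : Matroid (Fin n)}

lemma mem_nbc {I : Subsets n ℓ} : I ∈ nbc M ℓ ↔
    M.Indep (I.1 : Set (Fin n)) ∧ ∀ B : Finset (Fin n), IsBrokenCircuit M B → ¬ B ⊆ I.1 := by
  simp [nbc]

/-- Otherwise `a` would be the least element of a circuit in `insert a S`, and the rest of that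
circuit would be a broken circuit inside `X`. That `a` is not a loop makes the circuit large enough.
-/
lemma exists_le_of_mem_closure {X : Finset (Fin n)}
    (hX : ∀ B : Finset (Fin n), IsBrokenCircuit M B → ¬ B ⊆ X) {S : Set (Fin n)}
    (hS : S ⊆ X) {a : Fin n} (ha : a ∈ M.closure S) (ha0 : a ∉ M.closure ∅) :
    ∃ s ∈ S, s ≤ a := by
  by_contra! hlt
  obtain ⟨C, hCS, hC, haC⟩ :=
    M.exists_isCircuit_of_mem_closure ha fun haS => lt_irrefl _ (hlt a haS)
  have hmem := hC.mem_closure_sdiff_singleton_of_mem haC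
  lift C to Finset (Fin n) using Set.toFinite C
  refine hX (C.erase a) ⟨C, hC, ?_, a, haC, ?_, rfl⟩ ?_
  · by_contra hcard
    have : (C : Set (Fin n)) \ {a} = ∅ := by
      ext y
      simp only [Set.mem_sdiff, Set.mem_singleton_iff, Set.mem_empty_iff_false, iff_false, not_and,
        not_not]
      exact fun hy => Finset.card_le_one.1 (not_lt.1 hcard) y hy a haC
    exact ha0 (this ▸ hmem)
  · intro y hy
    rcases hCS hy with rfl | hyS
    exacts [le_rfl, (hlt y hyS).le]
  · intro y hy
    exact hS ((hCS (Finset.mem_of_mem_erase hy)).resolve_left (Finset.ne_of_mem_erase hy))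

lemma eq_of_mem_nbc_of_mem_slot (hE : M.E = Set.univ) {I J : Subsets n ℓ} (hI : I ∈ nbc M ℓ)
    (hJ : J ∈ nbc M ℓ) {τ : Equiv.Perm (Fin ℓ)}
    (h : ∀ p, ordered J τ p ∈ slot M (ordered I 1) p) : J = I := by
  have hmono : StrictMono (ordered I 1) := (I.1.orderEmbOfFin I.2).strictMono
  have hsub : ∀ (X : Subsets n ℓ) (σ : Equiv.Perm (Fin ℓ)) (s : Set (Fin ℓ)),
      ordered X σ '' s ⊆ X.1 := fun X σ s => by
    rw [← range_ordered X σ]; exact Set.image_subset_range _ _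
  have h0 : ∀ {x p}, x ∈ slot M (ordered I 1) p → x ∉ M.closure ∅ := fun hx h' =>
    hx.2 (M.closure_subset_closure (Set.empty_subset _) h')
  -- The entry of `J` at `p` lies in the closure of the entries of `I` from `p` on, the least of
  -- which is the one at `p`.
  have hle : ∀ p, ordered I 1 p ≤ ordered J τ p := by
    intro p
    obtain ⟨_, ⟨j, hj, rfl⟩, hle⟩ :=
      exists_le_of_mem_closure (mem_nbc.1 hI).2 (hsub I 1 _) (h p).1 (h0 (h p))
    exact (hmono.monotone hj).trans hle
  have heq : ∀ p, ordered J τ p = ordered I 1 p := by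
    intro p
    have hp := mem_slot_self hE (ordered_notMem_tail I 1 (mem_nbc.1 hI).1) p
    have hp1 := hp.1
    rw [← tail_eq_of_mem_slot h] at hp1
    obtain ⟨_, ⟨j, hj, rfl⟩, hjp⟩ :=
      exists_le_of_mem_closure (mem_nbc.1 hJ).2 (hsub J τ _) hp1 (h0 hp)
    -- With the roles of `I` and `J` exchanged, some `j ≥ p` satisfies `I_j ≤ J_{τ j} ≤ I_p`, and
    -- `I` is increasing, so `j = p`.
    have hjp' : j = p := le_antisymm (hmono.le_iff_le.1 ((hle j).trans hjp)) hj
    subst hjp'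
    exact le_antisymm hjp (hle j)
  refine Subtype.ext (Finset.coe_injective ?_)
  rw [← range_ordered J τ, ← range_ordered I 1, funext heq]

end NoBrokenCircuit

/-! ### Circuits and unidependent sets. -/

section Dependence

variable {n : ℕ} {M : Matroid (Fin n)}

lemma unidependent_of_indep_erase {C U : Finset (Fin n)} (hC : M.IsCircuit (C : Set (Fin n)))
    (hCU : C ⊆ U) {x : Fin n} (h : M.Indep (U.erase x : Set (Fin n))) : Unidependent M U := by
  have hsub : (U : Set (Fin n)) ⊆ insert x (U.erase x : Set (Fin n)) := by
    intro y hy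
    by_cases hyx : y = x
    · exact Or.inl hyx
    · exact Or.inr (Finset.mem_erase.2 ⟨hyx, hy⟩)
  refine ⟨C, ⟨hC, Finset.coe_subset.2 hCU⟩, fun D hD => ?_⟩
  rw [hD.1.eq_fundCircuit_of_subset h (hD.2.trans hsub),
    hC.eq_fundCircuit_of_subset h ((Finset.coe_subset.2 hCU).trans hsub)]

lemma unidependent_of_isCircuit {C : Finset (Fin n)} (hC : M.IsCircuit (C : Set (Fin n))) :
    Unidependent M C :=
  ⟨C, ⟨hC, subset_rfl⟩, fun _ hD => hD.1.eq_of_subset_isCircuit hC hD.2⟩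

lemma not_indep_of_isCircuit_subset {C U : Finset (Fin n)}
    (hC : M.IsCircuit (C : Set (Fin n))) (h : C ⊆ U) : ¬ M.Indep (U : Set (Fin n)) :=
  fun hU => hC.not_indep (hU.subset (Finset.coe_subset.2 h))

lemma exists_isCircuit_subset_of_not_indep (hE : M.E = Set.univ) {X : Finset (Fin n)}
    (h : ¬ M.Indep (X : Set (Fin n))) :
    ∃ C : Finset (Fin n), M.IsCircuit (C : Set (Fin n)) ∧ C ⊆ X := by
  obtain ⟨C, hCX, hC⟩ := ((M.not_indep_iff (by simp [hE])).1 h).exists_isCircuit_subset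
  lift C to Finset (Fin n) using Set.toFinite C
  exact ⟨C, hC, Finset.coe_subset.1 hCX⟩

lemma notMem_closure_empty_of_mem_isCircuit {C : Finset (Fin n)}
    (hC : M.IsCircuit (C : Set (Fin n))) (hcard : 1 < C.card) {x : Fin n} (hx : x ∈ C) :
    x ∉ M.closure ∅ := by
  have hi : M.Indep {x} := by
    refine hC.ssubset_indep ⟨by simpa using hx, fun h => ?_⟩
    have : C ⊆ {x} := by simpa [← Finset.coe_subset] using h
    exact hcard.not_ge (by simpa using Finset.card_le_card this)
  simpa using hi.notMem_closure_sdiff_of_mem rfl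

/-- If `C` is a circuit contained in `U`, an element whose removal makes `U` independent belongs
to `C`. -/
lemma mem_of_indep_erase {C U : Finset (Fin n)} (hC : M.IsCircuit (C : Set (Fin n)))
    (hCU : C ⊆ U) {x : Fin n} (h : M.Indep (U.erase x : Set (Fin n))) : x ∈ C := by
  by_contra hx
  exact not_indep_of_isCircuit_subset hC (Finset.subset_erase.2 ⟨hCU, hx⟩) h

end Dependence

/-! ### The residue along a flag vanishes on the ideal. -/

section Residue

variable {K : Type*} [Field K] {n ℓ : ℕ} {M : Matroid (Fin n)} {β : Fin n → Fin n → K}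
  {χ : Finset (Fin n) → K}

lemma boundary_mul_mon (C Y : Finset (Fin n)) (hC : C.card ≠ 1) :
    boundary β χ C * mon β Y =
      ∑ x ∈ C, ((-1 : K) ^ (C.filter (· ≤ x)).card * χ (C.erase x)) •
        (mon β (C.erase x) * mon β Y) := by
  rw [boundary, if_neg hC, Finset.sum_mul]
  simp only [smul_mul_assoc]

variable (M β χ) in
/-- The iterated residue along the flag of an ordered set, as a linear form on the skew algebra. -/
noncomputable def skewResidue (f : Fin ℓ → Fin n) : Skew β →ₗ[K] K :=
  monForm β fun X => (χ X)⁻¹ * slotDet K M f X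

lemma skewResidue_mon_of_not_indep (h : IsChiAlgebra M β χ) (f : Fin ℓ → Fin n)
    {X : Finset (Fin n)} (hX : ¬ M.Indep (X : Set (Fin n))) :
    skewResidue M β χ f (mon β X) = 0 := by
  rw [skewResidue, monForm_mon, not_not.1 (mt (h.chi_ne_zero_iff X).1 hX), inv_zero, zero_mul]

/-- For dependent `X`, where `(χ X)⁻¹` is the default `0`, both sides vanish: a transversal of the
slots is independent. -/
lemma chi_mul_skewResidue_mon (hE : M.E = Set.univ) (h : IsChiAlgebra M β χ)
    (f : Fin ℓ → Fin n) (X : Finset (Fin n)) :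
    χ X * skewResidue M β χ f (mon β X) = slotDet K M f X := by
  rw [skewResidue, monForm_mon]
  by_cases hX : χ X = 0
  · rw [hX, zero_mul]
    by_contra hne
    have hc : X.card = ℓ := by
      by_contra hc
      exact hne (by rw [slotDet, dif_neg hc])
    obtain ⟨τ, hτ⟩ := exists_mem_slot_of_slotDet_ne_zero ⟨X, hc⟩ (Ne.symm hne)
    exact (h.chi_ne_zero_iff X).2 (indep_of_mem_slot hE ⟨X, hc⟩ hτ) hX
  · rw [mul_inv_cancel_left₀ hX]

lemma skewResidue_boundary (hE : M.E = Set.univ) (h : IsChiAlgebra M β χ) (f : Fin ℓ → Fin n)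
    {C U : Finset (Fin n)} (hC : M.IsCircuit (C : Set (Fin n))) (hcard : 1 < C.card)
    (hCU : C ⊆ U) : skewResidue M β χ f (boundary β χ U) = 0 := by
  have hU1 : U.card ≠ 1 := (hcard.trans_le (Finset.card_le_card hCU)).ne'
  simp only [boundary, if_neg hU1, map_sum, map_smul, smul_eq_mul, mul_assoc,
    chi_mul_skewResidue_mon hE h]
  by_cases hU : U.card = ℓ + 1
  · refine sum_slotDet_erase K hE hU fun x _ hi => ?_
    have hx := mem_of_indep_erase hC hCU hi
    refine ⟨M.closure_subset_closure ?_ (hC.mem_closure_sdiff_singleton_of_mem hx),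
      notMem_closure_empty_of_mem_isCircuit hC hcard hx⟩
    rw [Finset.coe_erase]
    exact Set.sdiff_subset_sdiff_left (Finset.coe_subset.2 hCU)
  · refine Finset.sum_eq_zero fun x hx => ?_
    have hne : (U.erase x).card ≠ ℓ := by
      have := Finset.card_erase_add_one hx
      omega
    rw [slotDet, dif_neg hne, mul_zero]

lemma skewResidue_boundary_mul_mon (hE : M.E = Set.univ) (h : IsChiAlgebra M β χ)
    (f : Fin ℓ → Fin n) {C : Finset (Fin n)} (hC : M.IsCircuit (C : Set (Fin n)))
    (hcard : 1 < C.card) (Y : Finset (Fin n)) :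
    skewResidue M β χ f (boundary β χ C * mon β Y) = 0 := by
  -- In the main case condition (ii) makes the product a multiple of `∂ e_{C ∪ Y}`. Otherwise each
  -- term of the product is zero or a multiple of a dependent monomial.
  by_cases hu : Disjoint C Y ∧ Unidependent M (C ∪ Y)
  · obtain ⟨ε, hε, heq⟩ := h.boundary_eq (C ∪ Y) C hu.2 (unidependent_of_isCircuit hC)
      Finset.subset_union_left
    rw [Finset.union_sdiff_cancel_left hu.1] at heq
    have := skewResidue_boundary hE h f hC hcard (Finset.subset_union_left (s₂ := Y))
    rw [heq, map_smul, smul_eq_mul] at this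
    exact (mul_eq_zero.1 this).resolve_left hε
  · rw [boundary_mul_mon C Y hcard.ne', map_sum]
    refine Finset.sum_eq_zero fun x hx => ?_
    rw [map_smul, mon_mul_mon]
    split_ifs with hd
    · rw [map_smul, skewResidue_mon_of_not_indep h f, smul_zero, smul_zero]
      intro hi
      by_cases hxY : x ∈ Y
      · refine not_indep_of_isCircuit_subset hC (fun y hy => ?_) hi
        by_cases hyx : y = x
        · exact Finset.mem_union_right _ (hyx ▸ hxY)
        · exact Finset.mem_union_left _ (Finset.mem_erase.2 ⟨hyx, hy⟩)
      · have hCY : Disjoint C Y := by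
          rw [← Finset.insert_erase hx, Finset.disjoint_insert_left]
          exact ⟨hxY, hd⟩
        refine hu ⟨hCY, unidependent_of_indep_erase hC Finset.subset_union_left (x := x) ?_⟩
        rwa [Finset.erase_union_distrib, Finset.erase_eq_of_notMem hxY]
    · rw [map_zero, smul_zero]

lemma skewResidue_gen_mul_mon (h : IsChiAlgebra M β χ) (f : Fin ℓ → Fin n) {i : Fin n}
    (hi : M.IsCircuit {i}) (Y : Finset (Fin n)) :
    skewResidue M β χ f (gen β i * mon β Y) = 0 := by
  rw [gen_mul_mon]
  split_ifs
  · rw [map_zero]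
  · rw [map_smul, skewResidue_mon_of_not_indep h f, smul_zero]
    exact not_indep_of_isCircuit_subset (C := {i}) (by simpa using hi) (by simp)

lemma skewResidue_eq_zero_of_mem (hE : M.E = Set.univ) (h : IsChiAlgebra M β χ)
    (f : Fin ℓ → Fin n) {a : Skew β} (ha : a ∈ chiIdeal M β χ) :
    skewResidue M β χ f a = 0 := by
  -- The claim is strengthened to all right multiples so that the induction passes through the right
  -- action.
  suffices ∀ b, skewResidue M β χ f (a * b) = 0 by simpa using this 1
  induction ha using Submodule.span_induction with
  | mem a ha =>
    intro b
    have hb : b ∈ Submodule.span K (Set.range (mon β)) := by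
      rw [span_range_mon]; exact Submodule.mem_top
    induction hb using Submodule.span_induction with
    | mem b hb =>
      obtain ⟨Y, rfl⟩ := hb
      rcases ha with ⟨C, hC, hcard, rfl⟩ | ⟨i, hi, rfl⟩
      · exact skewResidue_boundary_mul_mon hE h f hC hcard Y
      · exact skewResidue_gen_mul_mon h f hi Y
    | zero => simp
    | add b c _ _ hb hc => rw [mul_add, map_add, hb, hc, add_zero]
    | smul r b _ hb => rw [mul_smul_comm, map_smul, hb, smul_zero]
  | zero => simp
  | add a c _ _ ha hc => intro b; rw [add_mul, map_add, ha, hc, add_zero]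
  | smul r a _ ha =>
    intro b
    rw [MulOpposite.smul_eq_mul_unop, mul_assoc]
    exact ha _

/-- The iterated residue along the flag of an ordered set, as a linear form on the `χ`-algebra. -/
noncomputable def residue (hE : M.E = Set.univ) (h : IsChiAlgebra M β χ) (f : Fin ℓ → Fin n) :
    ChiAlgebra M β χ →ₗ[K] K :=
  ((chiIdeal M β χ).restrictScalars K).liftQ (skewResidue M β χ f) fun _ ha =>
    skewResidue_eq_zero_of_mem hE h f ha

lemma residue_cls (hE : M.E = Set.univ) (h : IsChiAlgebra M β χ) (f : Fin ℓ → Fin n)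
    (X : Finset (Fin n)) :
    residue hE h f (cls M β χ X) = (χ X)⁻¹ * slotDet K M f X := by
  change skewResidue M β χ f (mon β X) = _
  rw [skewResidue, monForm_mon]

end Residue

/-! ### Straightening: NBC classes span. -/

section Spanning

variable {K : Type*} [Field K] {n ℓ : ℕ} {M : Matroid (Fin n)} {β : Fin n → Fin n → K}
  {χ : Finset (Fin n) → K}

lemma mul_mem_chiIdeal {a : Skew β} (ha : a ∈ chiIdeal M β χ) (b : Skew β) :
    a * b ∈ chiIdeal M β χ :=
  Submodule.smul_mem _ (MulOpposite.op b) ha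

lemma boundary_mul_mem_chiIdeal {C : Finset (Fin n)} (hC : M.IsCircuit (C : Set (Fin n)))
    (hcard : 1 < C.card) (b : Skew β) : boundary β χ C * b ∈ chiIdeal M β χ :=
  mul_mem_chiIdeal (Submodule.subset_span (Or.inl ⟨C, hC, hcard, rfl⟩)) b

lemma boundary_coeff_ne_zero (h : IsChiAlgebra M β χ) {C : Finset (Fin n)}
    (hC : M.IsCircuit (C : Set (Fin n))) {x : Fin n} (hx : x ∈ C) :
    (-1 : K) ^ (C.filter (· ≤ x)).card * χ (C.erase x) ≠ 0 := by
  refine mul_ne_zero (pow_ne_zero _ (neg_ne_zero.2 one_ne_zero)) ((h.chi_ne_zero_iff _).2 ?_)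
  rw [Finset.coe_erase]
  exact hC.sdiff_singleton_indep hx

lemma mon_mem_chiIdeal_of_not_indep (hE : M.E = Set.univ) (h : IsChiAlgebra M β χ)
    {X : Finset (Fin n)} (hX : ¬ M.Indep (X : Set (Fin n))) :
    mon β X ∈ (chiIdeal M β χ).restrictScalars K := by
  obtain ⟨C, hC, hCX⟩ := exists_isCircuit_subset_of_not_indep hE hX
  obtain ⟨c, hc⟩ := Finset.coe_nonempty.1 hC.nonempty
  rcases eq_or_lt_of_le (Nat.succ_le_of_lt (Finset.card_pos.2 ⟨c, hc⟩)) with hcard | hcard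
  · obtain ⟨i, rfl⟩ := Finset.card_eq_one.1 hcard.symm
    rw [Finset.coe_singleton] at hC
    have hm : gen β i * mon β (X.erase i) ∈ (chiIdeal M β χ).restrictScalars K :=
      mul_mem_chiIdeal (Submodule.subset_span (Or.inr ⟨i, hC, rfl⟩)) _
    rw [gen_mul_mon, if_neg (Finset.notMem_erase _ _),
      Finset.insert_erase (Finset.singleton_subset_iff.1 hCX)] at hm
    exact (Submodule.smul_mem_iff _ (crossing_ne_zero h.beta_ne_zero _ _)).1 hm
  · have hm : boundary β χ C * mon β (insert c (X \ C)) ∈ (chiIdeal M β χ).restrictScalars K :=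
      boundary_mul_mem_chiIdeal hC hcard _
    have hd : Disjoint (C.erase c) (insert c (X \ C)) := by
      rw [Finset.disjoint_insert_right]
      exact ⟨Finset.notMem_erase _ _,
        Finset.disjoint_sdiff.mono_left (Finset.erase_subset _ _)⟩
    have hun : C.erase c ∪ insert c (X \ C) = X := by
      rw [Finset.union_insert, ← Finset.insert_union, Finset.insert_erase hc,
        Finset.union_sdiff_of_subset hCX]
    rw [boundary_mul_mon _ _ hcard.ne', Finset.sum_eq_single c, mon_mul_mon_of_disjoint β hd, hun,
      Submodule.smul_mem_iff _ (boundary_coeff_ne_zero h hC hc),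
      Submodule.smul_mem_iff _ (crossing_ne_zero h.beta_ne_zero _ _)] at hm
    · exact hm
    · intro x _ hxc
      rw [mon_mul_mon_of_not_disjoint, smul_zero]
      exact Finset.not_disjoint_iff.2
        ⟨c, Finset.mem_erase.2 ⟨Ne.symm hxc, hc⟩, Finset.mem_insert_self _ _⟩
    · exact fun hc' => absurd hc hc'

lemma cls_eq_zero_of_not_indep (hE : M.E = Set.univ) (h : IsChiAlgebra M β χ)
    {X : Finset (Fin n)} (hX : ¬ M.Indep (X : Set (Fin n))) : cls M β χ X = 0 := by
  rw [cls, Submodule.mkQ_apply, Submodule.Quotient.mk_eq_zero]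
  exact mon_mem_chiIdeal_of_not_indep hE h hX

variable (M β χ) in
/-- The span of the classes of the no broken circuit sets. -/
noncomputable def nbcSpan (ℓ : ℕ) : Submodule K (ChiAlgebra M β χ) :=
  Submodule.span K
    (Set.range fun I : {I : Subsets n ℓ // I ∈ nbc M ℓ} => cls M β χ I.1.1)

/-- If `X` contains the broken circuit `C.erase a`, the relation `∂ e_C * e_Y`, with `Y` the rest of
`X`, expresses `[X]` through sets in which some `x > a` is replaced by `a`. Their element sums are
smaller. -/
lemma cls_mem_nbcSpan_of_forall_lt (hE : M.E = Set.univ) (h : IsChiAlgebra M β χ)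
    (X : Subsets n ℓ)
    (ih : ∀ Y : Subsets n ℓ, ∑ y ∈ Y.1, (y : ℕ) < ∑ x ∈ X.1, (x : ℕ) →
      cls M β χ Y.1 ∈ nbcSpan M β χ ℓ) :
    cls M β χ X.1 ∈ nbcSpan M β χ ℓ := by
  by_cases hi : M.Indep (X.1 : Set (Fin n))
  swap
  · rw [cls_eq_zero_of_not_indep hE h hi]
    exact Submodule.zero_mem _
  by_cases hX : X ∈ nbc M ℓ
  · exact Submodule.subset_span ⟨⟨X, hX⟩, rfl⟩
  rw [mem_nbc] at hX
  push Not at hX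
  obtain ⟨_, ⟨C, hC, hcard, a, haC, hmin, rfl⟩, hBX⟩ := hX hi
  have haX : a ∉ X.1 := fun haX => not_indep_of_isCircuit_subset hC
    (by rw [← Finset.insert_erase haC]; exact Finset.insert_subset haX hBX) hi
  set Y := X.1 \ C.erase a with hY
  have hCY : Disjoint C Y := by
    rw [← Finset.insert_erase haC, Finset.disjoint_insert_left]
    exact ⟨fun h' => haX (Finset.sdiff_subset h'), Finset.disjoint_sdiff⟩
  have hd : ∀ x, Disjoint (C.erase x) Y := fun x => hCY.mono_left (Finset.erase_subset _ _)
  have hm : boundary β χ C * mon β Y ∈ (chiIdeal M β χ).restrictScalars K :=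
    boundary_mul_mem_chiIdeal hC hcard _
  rw [← Submodule.Quotient.mk_eq_zero, ← Submodule.mkQ_apply, boundary_mul_mon _ _ hcard.ne',
    ← Finset.add_sum_erase _ _ haC, map_add, map_sum, add_eq_zero_iff_eq_neg,
    mon_mul_mon_of_disjoint β (hd a), hY, Finset.union_sdiff_of_subset hBX, map_smul,
    map_smul] at hm
  rw [← Submodule.smul_mem_iff _ (crossing_ne_zero h.beta_ne_zero (C.erase a) (X.1 \ C.erase a)),
    ← Submodule.smul_mem_iff _ (boundary_coeff_ne_zero h hC haC), cls, hm]
  refine Submodule.neg_mem _ (Submodule.sum_mem _ fun x hx => ?_)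
  have hxa := Finset.ne_of_mem_erase hx
  have hax : a < x := lt_of_le_of_ne (hmin x (Finset.mem_of_mem_erase hx)) hxa.symm
  have hxX : x ∈ X.1 := hBX hx
  have haX' : a ∉ X.1.erase x := fun h' => haX (Finset.mem_of_mem_erase h')
  have hun : C.erase x ∪ Y = insert a (X.1.erase x) := by
    ext y
    have := @hBX y
    simp only [hY, Finset.mem_union, Finset.mem_erase, Finset.mem_sdiff, Finset.mem_insert]
      at this hx ⊢
    by_cases hya : y = a
    · subst hya; simp [haC, hxa.symm]
    · by_cases hyx : y = x
      · subst hyx; simp [hxa, hx.2]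
      · simp only [hya]; tauto
  rw [← hY, mon_mul_mon_of_disjoint β (hd x), hun, map_smul, map_smul]
  refine Submodule.smul_mem _ _ (Submodule.smul_mem _ _ (ih ⟨insert a (X.1.erase x), ?_⟩ ?_))
  · rw [Finset.card_insert_of_notMem haX', Finset.card_erase_add_one hxX, X.2]
  · rw [Finset.sum_insert haX', ← Finset.add_sum_erase X.1 _ hxX]
    exact Nat.add_lt_add_right hax _

lemma cls_mem_nbcSpan (hE : M.E = Set.univ) (h : IsChiAlgebra M β χ) (X : Subsets n ℓ) :
    cls M β χ X.1 ∈ nbcSpan M β χ ℓ := by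
  induction hs : ∑ x ∈ X.1, (x : ℕ) using Nat.strong_induction_on generalizing X with
  | _ s ih =>
    exact cls_mem_nbcSpan_of_forall_lt hE h X fun Y hY => ih _ (hs ▸ hY) Y rfl

lemma nbcSpan_eq_chiDeg (hE : M.E = Set.univ) (h : IsChiAlgebra M β χ) :
    nbcSpan M β χ ℓ = chiDeg M β χ ℓ := by
  refine le_antisymm (Submodule.span_le.2 ?_) ?_
  · rintro _ ⟨I, rfl⟩
    exact Submodule.mem_map_of_mem (Submodule.subset_span ⟨I.1.1, I.1.2, rfl⟩)
  · rw [chiDeg, skewDeg, Submodule.map_span, Submodule.span_le]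
    rintro _ ⟨_, ⟨X, hX, rfl⟩, rfl⟩
    exact cls_mem_nbcSpan hE h ⟨X, hX⟩

end Spanning

/-! ### Duality of residues and NBC classes. -/

section Coefficients

variable {K : Type*} [Field K] {n ℓ : ℕ} {M : Matroid (Fin n)} {β : Fin n → Fin n → K}
  {χ : Finset (Fin n) → K}

lemma residue_cls_self (hE : M.E = Set.univ) (h : IsChiAlgebra M β χ) {I : Subsets n ℓ}
    (hI : I ∈ nbc M ℓ) : residue hE h (ordered I 1) (cls M β χ I.1) = (χ I.1)⁻¹ := by
  rw [residue_cls, slotDet_of_mem_slot K I (τ := 1)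
    (mem_slot_self hE (ordered_notMem_tail I 1 (mem_nbc.1 hI).1))]
  simp

lemma residue_cls_of_ne (hE : M.E = Set.univ) (h : IsChiAlgebra M β χ) {I J : Subsets n ℓ}
    (hI : I ∈ nbc M ℓ) (hJ : J ∈ nbc M ℓ) (hJI : J ≠ I) :
    residue hE h (ordered I 1) (cls M β χ J.1) = 0 := by
  rw [residue_cls, mul_eq_zero]
  right
  by_contra hne
  obtain ⟨τ, hτ⟩ := exists_mem_slot_of_slotDet_ne_zero J hne
  exact hJI (eq_of_mem_nbc_of_mem_slot hE hI hJ hτ)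

lemma chi_ne_zero_of_mem_nbc (h : IsChiAlgebra M β χ) {I : Subsets n ℓ} (hI : I ∈ nbc M ℓ) :
    χ I.1 ≠ 0 :=
  (h.chi_ne_zero_iff _).2 (mem_nbc.1 hI).1

lemma residue_sum_cls (hE : M.E = Set.univ) (h : IsChiAlgebra M β χ) (ξ : Subsets n ℓ → K)
    {I : Subsets n ℓ} (hI : I ∈ nbc M ℓ) :
    residue hE h (ordered I 1) (∑ J ∈ nbc M ℓ, ξ J • cls M β χ J.1) = ξ I * (χ I.1)⁻¹ := by
  rw [map_sum, Finset.sum_eq_single_of_mem I hI, map_smul, residue_cls_self hE h hI, smul_eq_mul]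
  intro J hJ hJI
  rw [map_smul, residue_cls_of_ne hE h hI hJ hJI, smul_zero]

lemma coeff_eq_slotDet (hE : M.E = Set.univ) (h : IsChiAlgebra M β χ) {J : Subsets n ℓ}
    {ξ : Subsets n ℓ → K} (hξ : cls M β χ J.1 = ∑ I ∈ nbc M ℓ, ξ I • cls M β χ I.1)
    {I : Subsets n ℓ} (hI : I ∈ nbc M ℓ) :
    ξ I = χ I.1 * ((χ J.1)⁻¹ * slotDet K M (ordered I 1) J.1) := by
  have := congrArg (residue hE h (ordered I 1)) hξ
  rw [residue_sum_cls hE h ξ hI, residue_cls] at this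
  rw [this, mul_comm (ξ I), mul_inv_cancel_left₀ (chi_ne_zero_of_mem_nbc h hI)]

lemma linearIndependent_cls_nbc (hE : M.E = Set.univ) (h : IsChiAlgebra M β χ) :
    LinearIndependent K
      (fun I : {I : Subsets n ℓ // I ∈ nbc M ℓ} => cls M β χ I.1.1) := by
  classical
  rw [Fintype.linearIndependent_iff]
  intro c hc I
  -- The coefficients are extended by zero to all subsets of size `ℓ`.
  have := residue_sum_cls hE h (fun J => if hJ : J ∈ nbc M ℓ then c ⟨J, hJ⟩ else 0) I.2
  rw [← Finset.sum_attach, ← Finset.univ_eq_attach] at this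
  simp only [SetLike.coe_mem, dite_true, Subtype.coe_eta] at this
  rw [hc, map_zero] at this
  exact (mul_eq_zero.1 this.symm).resolve_right (inv_ne_zero (chi_ne_zero_of_mem_nbc h I.2))

lemma sign_inv_eq (τ : Equiv.Perm (Fin ℓ)) :
    (((Equiv.Perm.sign τ : ℤ) : K))⁻¹ = ((Equiv.Perm.sign τ : ℤ) : K) := by
  rcases Int.units_eq_one_or (Equiv.Perm.sign τ) with h | h <;> simp [h]

lemma sign_ne_zero (τ : Equiv.Perm (Fin ℓ)) : ((Equiv.Perm.sign τ : ℤ) : K) ≠ 0 := by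
  rcases Int.units_eq_one_or (Equiv.Perm.sign τ) with h | h <;> simp [h]

lemma coeff_eq_of_flag_eq (hE : M.E = Set.univ) (h : IsChiAlgebra M β χ) {J : Subsets n ℓ}
    {ξ : Subsets n ℓ → K} (hξ : cls M β χ J.1 = ∑ I ∈ nbc M ℓ, ξ I • cls M β χ I.1)
    {I : Subsets n ℓ} (hI : I ∈ nbc M ℓ) {τ : Equiv.Perm (Fin ℓ)}
    (hτ : flag M I 1 = flag M J τ) : ξ I = χ I.1 / chiOrd χ J τ := by
  rw [flag_eq_flag_iff_mem_slot hE (mem_nbc.1 hI).1] at hτ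
  rw [coeff_eq_slotDet hE h hξ hI, slotDet_of_mem_slot K J hτ, chiOrd, div_eq_mul_inv, mul_inv,
    sign_inv_eq, mul_comm (χ J.1)⁻¹]

lemma coeff_ne_zero_iff (hE : M.E = Set.univ) (h : IsChiAlgebra M β χ) {J : Subsets n ℓ}
    {ξ : Subsets n ℓ → K} (hξ : cls M β χ J.1 = ∑ I ∈ nbc M ℓ, ξ I • cls M β χ I.1)
    {I : Subsets n ℓ} (hI : I ∈ nbc M ℓ) :
    ξ I ≠ 0 ↔ ∃ τ : Equiv.Perm (Fin ℓ), flag M I 1 = flag M J τ := by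
  constructor
  · intro hne
    rw [coeff_eq_slotDet hE h hξ hI] at hne
    obtain ⟨τ, hτ⟩ :=
      exists_mem_slot_of_slotDet_ne_zero J (right_ne_zero_of_mul (right_ne_zero_of_mul hne))
    exact ⟨τ, (flag_eq_flag_iff_mem_slot hE (mem_nbc.1 hI).1 _ _ _).2 hτ⟩
  · rintro ⟨τ, hτ⟩
    rw [coeff_eq_of_flag_eq hE h hξ hI hτ]
    rw [flag_eq_flag_iff_mem_slot hE (mem_nbc.1 hI).1] at hτ
    exact div_ne_zero (chi_ne_zero_of_mem_nbc h hI) (mul_ne_zero (sign_ne_zero τ)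
      ((h.chi_ne_zero_iff _).2 (indep_of_mem_slot hE J hτ)))

lemma isDiagonalBasis_nbc (hE : M.E = Set.univ) (h : IsChiAlgebra M β χ) :
    IsDiagonalBasis M β χ ℓ (nbc M ℓ) (fun _ => 1) where
  indep I hI := (mem_nbc.1 hI).1
  finrank_le := by
    have hinj := (linearIndependent_cls_nbc (ℓ := ℓ) hE h).injective
    rw [← nbcSpan_eq_chiDeg hE h, nbcSpan,
      finrank_span_eq_card (linearIndependent_cls_nbc hE h), Set.InjOn.ncard_image,
      Set.ncard_coe_finset, Fintype.card_coe]
    exact fun I hI J hJ hIJ => congrArg Subtype.val (@hinj ⟨I, hI⟩ ⟨J, hJ⟩ hIJ)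
  eq_of_flag_eq I hI J hJ τ hτ :=
    eq_of_mem_nbc_of_mem_slot hE hI hJ
      ((flag_eq_flag_iff_mem_slot hE (mem_nbc.1 hI).1 _ _ _).1 hτ.symm)

end Coefficients

/-! ### The Orlik–Solomon algebra as a `χ`-algebra. -/

section OrlikSolomon

variable (K : Type*) [Field K] {n ℓ : ℕ} (M : Matroid (Fin n))

lemma crossing_osBeta (X Y : Finset (Fin n)) :
    crossing (osBeta K n) X Y = ∏ x ∈ X, (-1 : K) ^ (Y.filter (· < x)).card := by
  simp [crossing, osBeta]

lemma crossing_osBeta_mul_self (X Y : Finset (Fin n)) :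
    crossing (osBeta K n) X Y * crossing (osBeta K n) X Y = 1 := by
  rw [crossing_osBeta, ← Finset.prod_mul_distrib]
  exact Finset.prod_eq_one fun x _ => by rw [← mul_pow]; simp

lemma crossing_osBeta_erase {X : Finset (Fin n)} (Y : Finset (Fin n)) {x : Fin n} (hx : x ∈ X) :
    crossing (osBeta K n) X Y =
      (-1 : K) ^ (Y.filter (· < x)).card * crossing (osBeta K n) (X.erase x) Y := by
  rw [crossing_osBeta, crossing_osBeta,
    Finset.mul_prod_erase X (fun x => (-1 : K) ^ (Y.filter (· < x)).card) hx]

variable {M}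

lemma osChi_of_indep {X : Finset (Fin n)} (h : M.Indep (X : Set (Fin n))) : osChi K M X = 1 :=
  if_pos h

lemma osChi_of_not_indep {X : Finset (Fin n)} (h : ¬ M.Indep (X : Set (Fin n))) :
    osChi K M X = 0 :=
  if_neg h

/-- The independent sets `U \ x` in a set `U` with the unique circuit `C` are those with
`x ∈ C`. -/
lemma indep_erase_iff (hE : M.E = Set.univ) {C U : Finset (Fin n)}
    (hC : M.IsCircuit (C : Set (Fin n))) (hCU : C ⊆ U) (hU : Unidependent M U) (x : Fin n) :
    M.Indep (U.erase x : Set (Fin n)) ↔ x ∈ C := by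
  refine ⟨mem_of_indep_erase hC hCU, fun hx => by_contra fun hi => ?_⟩
  obtain ⟨D, hD, hDU⟩ := exists_isCircuit_subset_of_not_indep hE hi
  have : (D : Set (Fin n)) = C := hU.unique
    ⟨hD, Finset.coe_subset.2 (hDU.trans (Finset.erase_subset _ _))⟩ ⟨hC, Finset.coe_subset.2 hCU⟩
  rw [Finset.coe_inj] at this
  subst this
  exact Finset.notMem_erase x U (hDU hx)

/-- Both boundaries have nonzero terms exactly at `x ∈ C`. Passing from `U'` to `U` shifts the
position of `x` by the number of smaller elements of `U \ U'`, which is also the sign that `x`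
contributes to the crossing factor. -/
lemma boundary_osChi_eq (hE : M.E = Set.univ) {C U U' : Finset (Fin n)}
    (hC : M.IsCircuit (C : Set (Fin n))) (hCU' : C ⊆ U') (hU'U : U' ⊆ U)
    (hU : Unidependent M U) (hU' : Unidependent M U') (hcard' : U'.card ≠ 1)
    (hcard : U.card ≠ 1) :
    boundary (osBeta K n) (osChi K M) U = crossing (osBeta K n) U' (U \ U') •
      (boundary (osBeta K n) (osChi K M) U' * mon (osBeta K n) (U \ U')) := by
  rw [boundary_mul_mon _ _ hcard', boundary, if_neg hcard, Finset.smul_sum]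
  symm
  have hC0 {X : Finset (Fin n)} : C ⊆ X → ¬ M.Indep (X : Set (Fin n)) := not_indep_of_isCircuit_subset hC
  rw [← Finset.sum_subset hU'U]
  swap
  · intro x _ hx
    rw [osChi_of_not_indep K (hC0 (Finset.subset_erase.2 ⟨hCU'.trans hU'U, fun h => hx (hCU' h)⟩)),
      mul_zero, zero_smul]
  refine Finset.sum_congr rfl fun x hx => ?_
  have hd : Disjoint (U'.erase x) (U \ U') :=
    Finset.disjoint_sdiff.mono_left (Finset.erase_subset _ _)
  have hun : U'.erase x ∪ U \ U' = U.erase x := by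
    ext y
    have := @hU'U y
    simp only [Finset.mem_union, Finset.mem_erase, Finset.mem_sdiff]
    by_cases hyx : y = x
    · subst hyx; simp [hx]
    · tauto
  have hpos : (U.filter (· ≤ x)).card =
      (U'.filter (· ≤ x)).card + ((U \ U').filter (· < x)).card := by
    rw [← Finset.card_union_of_disjoint]
    · congr 1
      ext y
      have := @hU'U y
      simp only [Finset.mem_union, Finset.mem_filter, Finset.mem_sdiff]
      rcases eq_or_ne y x with rfl | hyx
      · simp [hx, hU'U hx]
      · have := lt_iff_le_and_ne (a := y) (b := x)
        tauto
    · exact (Finset.disjoint_sdiff.mono (Finset.filter_subset _ _) (Finset.filter_subset _ _))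
  rw [mon_mul_mon_of_disjoint _ hd, hun, smul_smul, smul_smul]
  congr 1
  by_cases hxC : x ∈ C
  · rw [osChi_of_indep K ((indep_erase_iff hE hC hCU' hU' x).2 hxC),
      osChi_of_indep K ((indep_erase_iff hE hC (hCU'.trans hU'U) hU x).2 hxC), hpos, pow_add,
      crossing_osBeta_erase K _ hx]
    linear_combination ((-1 : K) ^ (U'.filter (· ≤ x)).card *
      (-1 : K) ^ ((U \ U').filter (· < x)).card) *
      crossing_osBeta_mul_self K (U'.erase x) (U \ U')
  · rw [osChi_of_not_indep K (hC0 (Finset.subset_erase.2 ⟨hCU', hxC⟩)),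
      osChi_of_not_indep K (hC0 (Finset.subset_erase.2 ⟨hCU'.trans hU'U, hxC⟩))]
    ring

/-- The Orlik–Solomon algebra is a `χ`-algebra. -/
lemma isChiAlgebra_os (hE : M.E = Set.univ) : IsChiAlgebra M (osBeta K n) (osChi K M) where
  beta_ne_zero _ _ _ := neg_ne_zero.2 one_ne_zero
  chi_ne_zero_iff I := by simp [osChi]
  boundary_eq U U' hU hU' hU'U := by
    obtain ⟨C, ⟨hC, hCU'⟩, -⟩ := id hU'
    lift C to Finset (Fin n) using Set.toFinite C
    rw [Finset.coe_subset] at hCU'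
    by_cases hcard' : U'.card = 1
    · by_cases hcard : U.card = 1
      · have : U' = U := Finset.eq_of_subset_of_card_le hU'U (by omega)
        subst this
        exact ⟨1, one_ne_zero, by simp [boundary, hcard, mon_empty]⟩
      obtain ⟨i, rfl⟩ := Finset.card_eq_one.1 hcard'
      have hCi : C = {i} := (Finset.subset_singleton_iff.1 hCU').resolve_left fun h0 =>
        hC.nonempty.ne_empty (by simp [h0])
      subst hCi
      -- Here `i` is a loop and `∂ eᵢ = 1` by convention. Only the term of `∂ e_U` omitting `i`
      -- survives, and `ε` is its sign.
      refine ⟨(-1) ^ (U.filter (· ≤ i)).card, pow_ne_zero _ (neg_ne_zero.2 one_ne_zero), ?_⟩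
      rw [boundary, if_neg hcard, boundary, if_pos hcard', one_mul, Finset.sdiff_singleton_eq_erase,
        Finset.sum_eq_single_of_mem i (Finset.singleton_subset_iff.1 hU'U),
        osChi_of_indep K ((indep_erase_iff hE hC hU'U hU i).2 (Finset.mem_singleton_self i)),
        mul_one]
      intro x _ hxi
      rw [osChi_of_not_indep K fun hi => hxi (Finset.mem_singleton.1 (mem_of_indep_erase hC hU'U hi)),
        mul_zero, zero_smul]
    · have hcard : U.card ≠ 1 := by
        have h1 : 0 < U'.card :=
          Finset.card_pos.2 ((Finset.coe_nonempty.1 hC.nonempty).mono hCU')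
        have h2 := Finset.card_le_card hU'U
        omega
      exact ⟨_, left_ne_zero_of_mul_eq_one (crossing_osBeta_mul_self K U' (U \ U')),
        boundary_osChi_eq K hE hC hCU' hU'U hU hU' hcard' hcard⟩

end OrlikSolomon

end ChiAlg

theorem mainTheorem6 {K : Type*} [Field K] {n : ℕ} (M : Matroid (Fin n)) (hE : M.E = Set.univ)
    (ℓ : ℕ) :
    (∀ (β : Fin n → Fin n → K) (χ : Finset (Fin n) → K), ChiAlg.IsChiAlgebra M β χ →
      ChiAlg.IsDiagonalBasis M β χ ℓ (ChiAlg.nbc M ℓ) (fun _ => 1) ∧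
      LinearIndependent K
        (fun I : {I : ChiAlg.Subsets n ℓ // I ∈ ChiAlg.nbc M ℓ} => ChiAlg.cls M β χ I.1.1) ∧
      Submodule.span K
        (Set.range fun I : {I : ChiAlg.Subsets n ℓ // I ∈ ChiAlg.nbc M ℓ} =>
          ChiAlg.cls M β χ I.1.1) = ChiAlg.chiDeg M β χ ℓ ∧
      ∀ (J : ChiAlg.Subsets n ℓ) (ξ : ChiAlg.Subsets n ℓ → K),
        ChiAlg.cls M β χ J.1 = ∑ I ∈ ChiAlg.nbc M ℓ, ξ I • ChiAlg.cls M β χ I.1 →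
        ∀ I ∈ ChiAlg.nbc M ℓ,
          (ξ I ≠ 0 ↔ ∃ τ : Equiv.Perm (Fin ℓ), ChiAlg.flag M I 1 = ChiAlg.flag M J τ) ∧
          ∀ τ : Equiv.Perm (Fin ℓ), ChiAlg.flag M I 1 = ChiAlg.flag M J τ →
            ξ I = χ I.1 / ChiAlg.chiOrd χ J τ) ∧
    (ChiAlg.IsChiAlgebra M (ChiAlg.osBeta K n) (ChiAlg.osChi K M) ∧
      ∀ (J : ChiAlg.Subsets n ℓ) (ξ : ChiAlg.Subsets n ℓ → K),
        ChiAlg.cls M (ChiAlg.osBeta K n) (ChiAlg.osChi K M) J.1 =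
          ∑ I ∈ ChiAlg.nbc M ℓ,
            ξ I • ChiAlg.cls M (ChiAlg.osBeta K n) (ChiAlg.osChi K M) I.1 →
        ∀ I ∈ ChiAlg.nbc M ℓ, ∀ τ : Equiv.Perm (Fin ℓ),
          ChiAlg.flag M I 1 = ChiAlg.flag M J τ →
            ξ I = ((Equiv.Perm.sign τ : ℤ) : K)) := by

  refine ⟨fun β χ h => ⟨ChiAlg.isDiagonalBasis_nbc hE h, ChiAlg.linearIndependent_cls_nbc hE h,
    ChiAlg.nbcSpan_eq_chiDeg hE h, fun J ξ hξ I hI => ⟨ChiAlg.coeff_ne_zero_iff hE h hξ hI,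
      fun τ hτ => ChiAlg.coeff_eq_of_flag_eq hE h hξ hI hτ⟩⟩,
    ChiAlg.isChiAlgebra_os K hE, fun J ξ hξ I hI τ hτ => ?_⟩
  rw [ChiAlg.coeff_eq_of_flag_eq hE (ChiAlg.isChiAlgebra_os K hE) hξ hI hτ]
  rw [ChiAlg.flag_eq_flag_iff_mem_slot hE (ChiAlg.mem_nbc.1 hI).1] at hτ
  -- As a transversal of the slots `J` is independent, so both values of `χ` are `1` and only the
  -- sign, its own inverse, remains.
  rw [ChiAlg.chiOrd, ChiAlg.osChi_of_indep K (ChiAlg.mem_nbc.1 hI).1,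
    ChiAlg.osChi_of_indep K (ChiAlg.indep_of_mem_slot hE J hτ), mul_one, one_div,
    ChiAlg.sign_inv_eq]
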